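/- Let $H(x) := -x\log x-(1-x)\log(1-x)$ denote the binary entropy on $[0,1]$ (natural logarithm, $0\log 0=0$). For real $k>1$ let $\alpha_k$ be the unique solution in $(0,1)$ of $\alpha_k = (1+\alpha_k)^{-(k-1)}$, and let $\alpha_1 := 1$. For integers $k\ge r\ge 1$ define $$h_{k,r}(x):=\sum_{j=0}^{k-1} x^{rj}\sum_{v=0}^j \frac{(-1)^{j-v}}{v+1}\binom{rv+k}{k}\binom{k}{j-v},$$ and for integers $k>r\ge 1$ define the entropy polynomial $$p_{k,r}(x):=\alpha_{k/r}\,k\,(1-x^r)^k\,h_{k,k}(x)-r\,(1-x^k)^k\,h_{k,r}(x).$$ **Theorem 1.3.** 1. Let $k>r\ge 1$ be integers. If $p_{k,r}$ has exactly two real roots in $(0,1)$, counting multiplicity, then $$\alpha_{k/r}\,H\!\left(x^{k/r}\right)\ \ge\ x^{k/r-1}H(x)\qquad\text{for all } 0\le x\le 1.$$ 2. If, for all coprime integers $k>r\ge 1$, the polynomial $p_{k,r}$ has exactly two real roots in $(0,1)$, counting multiplicity, then for every real $k\ge 1$ $$\alpha_k\,H\!\left(x^{k}\right)\ \ge\ x^{k-1}H(x)\qquad\text{for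 all } 0\le x\le 1.$$ -/

import Mathlib

namespace EntropyReduction

/-- For real `k ≥ 1`, the equation `a = 1 / (1 + a) ^ (k - 1)` has exactly one solution
`0 < a ≤ 1`. -/
theorem existsUnique_alpha {k : ℝ} (hk : 1 ≤ k) :
    ∃! a : ℝ, (0 < a ∧ a ≤ 1) ∧ a = 1 / (1 + a) ^ (k - 1) := by
  have key : ∀ a : ℝ, 0 < a → (a = 1 / (1 + a) ^ (k - 1) ↔ a * (1 + a) ^ (k - 1) = 1) := by
    intro a ha
    have : (0 : ℝ) < (1 + a) ^ (k - 1) := Real.rpow_pos_of_pos (by linarith) _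
    exact eq_div_iff this.ne'
  have hlt : ∀ a b : ℝ, 0 < a → a < b →
      a * (1 + a) ^ (k - 1) < b * (1 + b) ^ (k - 1) := by
    intro a b ha hab
    have h1 : (1 + a) ^ (k - 1) ≤ (1 + b) ^ (k - 1) :=
      Real.rpow_le_rpow (by linarith) (by linarith) (by linarith)
    have h2 : (0 : ℝ) < (1 + a) ^ (k - 1) := Real.rpow_pos_of_pos (by linarith) _
    nlinarith
  have hc : ContinuousOn (fun a : ℝ => a * (1 + a) ^ (k - 1)) (Set.Icc 0 1) :=
    continuousOn_id.mul
      ((continuousOn_const.add continuousOn_id).rpow_const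
        (fun x _ => Or.inr (by linarith)))
  obtain ⟨a, ha, hfa⟩ : (1 : ℝ) ∈ (fun a : ℝ => a * (1 + a) ^ (k - 1)) '' Set.Icc 0 1 := by
    apply intermediate_value_Icc zero_le_one hc
    refine ⟨by simp, ?_⟩
    have := Real.one_le_rpow (x := 1 + 1) (z := k - 1) (by norm_num) (by linarith)
    simpa using this
  have hfa' : a * (1 + a) ^ (k - 1) = 1 := hfa
  have ha0 : 0 < a := by
    rcases ha.1.lt_or_eq with h | h
    · exact h
    · rw [← h] at hfa'
      simp at hfa'
  refine ⟨a, ⟨⟨ha0, ha.2⟩, (key a ha0).2 hfa'⟩, ?_⟩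
  rintro b ⟨⟨hb0, -⟩, hb⟩
  have hfb := (key b hb0).1 hb
  rcases lt_trichotomy a b with h | h | h
  · exact absurd (hlt a b ha0 h) (by rw [hfa', hfb]; exact lt_irrefl _)
  · exact h.symm
  · exact absurd (hlt b a hb0 h) (by rw [hfa', hfb]; exact lt_irrefl _)

open Classical in
/-- The constant `α_k` for real `k ≥ 1`: the unique `0 < a ≤ 1` with
`a = 1 / (1 + a) ^ (k - 1)`. For `k > 1` it lies in `(0, 1)`, and `α_1 = 1`
(the value is irrelevant for `k < 1`). -/
noncomputable def alpha (k : ℝ) : ℝ :=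
  if hk : 1 ≤ k then (existsUnique_alpha hk).choose else 0

theorem alpha_spec {k : ℝ} (hk : 1 ≤ k) :
    (0 < alpha k ∧ alpha k ≤ 1) ∧ alpha k = 1 / (1 + alpha k) ^ (k - 1) := by
  have h := (existsUnique_alpha hk).choose_spec.1
  simpa only [alpha, dif_pos hk] using h

theorem alpha_lt_one {k : ℝ} (hk : 1 < k) : alpha k < 1 := by
  have h := alpha_spec hk.le
  rw [h.2, div_lt_one (Real.rpow_pos_of_pos (by linarith [h.1.1]) _)]
  exact Real.one_lt_rpow (by linarith [h.1.1]) (by linarith)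

theorem alpha_one : alpha 1 = 1 := by
  have h := (alpha_spec (le_refl (1 : ℝ))).2
  simpa using h

/-- The polynomial
`h_{k,r}(x) = ∑_{j=0}^{k-1} x^{rj} ∑_{v=0}^{j} (-1)^{j-v}/(v+1) * C(rv+k, k) * C(k, j-v)`. -/
noncomputable def h (k r : ℕ) : Polynomial ℝ :=
  ∑ j ∈ Finset.range k,
    Polynomial.C (∑ v ∈ Finset.range (j + 1),
      (-1 : ℝ) ^ (j - v) / ((v : ℝ) + 1) * ((r * v + k).choose k : ℝ) * (k.choose (j - v) : ℝ))
    * Polynomial.X ^ (r * j)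

/-- The entropy polynomial
`p_{k,r}(x) = α_{k/r} k (1 - x^r)^k h_{k,k}(x) - r (1 - x^k)^k h_{k,r}(x)`. -/
noncomputable def p (k r : ℕ) : Polynomial ℝ :=
  Polynomial.C (alpha ((k : ℝ) / (r : ℝ)) * (k : ℝ)) * (1 - Polynomial.X ^ r) ^ k * h k k
    - Polynomial.C (r : ℝ) * (1 - Polynomial.X ^ k) ^ k * h k r

open Classical in
/-- `p_{k,r}` has exactly two real roots in `(0, 1)`, counted with multiplicity. (The zero
polynomial, for which `Polynomial.roots` is empty, does not satisfy this.) -/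
def HasExactlyTwoRoots (k r : ℕ) : Prop :=
  Multiset.card ((p k r).roots.filter (fun x => x ∈ Set.Ioo (0 : ℝ) 1)) = 2

end EntropyReduction

/-! ### The logarithmic series and its `k`-th derivative. -/

namespace EntropyReduction

open Finset

/-! Put `x = t^r` and divide by `t^k`: the claim becomes `G ≥ 0` on `(0,1)` for `G(t) = α H(t^k)/t^k
- H(t^r)/t^r`, and `G' = w/t^(k+1)` with `w = αk log(1-t^k) - r t^(k-r) log(1-t^r)`. The equation
for `α` makes `G` and `w` vanish together at a point `t₀` with `t₀^k = 1 - t₀^r`. Also `G(1) = 0`,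
and `αk > r` gives points with `G ≥ 0` arbitrarily near both ends. A negative value of `G` would
force another zero, hence by Rolle three zeros of `w`.

The power series of `w` starts at degree `k`, so Rolle with the extra zero at `0` carries three
zeros to its `k`-th derivative. That derivative times `(1-x^r)^k (1-x^k)^k` is `-k! p_{k,r}`,
contradicting the root count.

Real exponents follow by approximation from above by rationals, since `α` is antitone. -/

/-- The `j`-th derivative of the power series `∑ x ^ (r v + k) / (v + 1)`. -/
noncomputable def logSeries (k r j : ℕ) (x : ℝ) : ℝ :=
  ∑' v : ℕ, ((r * v + k).descFactorial j : ℝ) / ((v : ℝ) + 1) * x ^ (r * v + k - j)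

theorem summable_succ_pow_mul_geometric (j : ℕ) {ρ : ℝ} (h0 : 0 < ρ) (h1 : ρ < 1) :
    Summable (fun v : ℕ => ((v : ℝ) + 1) ^ j * ρ ^ v) := by
  have h := summable_pow_mul_geometric_of_norm_lt_one j
    (show ‖ρ‖ < 1 by rwa [Real.norm_of_nonneg h0.le])
  have h2 := ((summable_nat_add_iff 1).2 h).mul_right ρ⁻¹
  refine h2.congr fun v => ?_
  push_cast
  rw [pow_succ, mul_assoc, mul_assoc, mul_inv_cancel₀ h0.ne', mul_one]

theorem norm_logSeries_term_le {k r j : ℕ} (hr : 1 ≤ r) (hj : j ≤ k) {x ρ : ℝ} (hx : |x| ≤ ρ)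
    (h1 : ρ < 1) (v : ℕ) :
    ‖((r * v + k).descFactorial j : ℝ) / ((v : ℝ) + 1) * x ^ (r * v + k - j)‖ ≤
      ((r : ℝ) + k) ^ j * (((v : ℝ) + 1) ^ j * ρ ^ v) := by
  have h0 : 0 ≤ ρ := (abs_nonneg x).trans hx
  have hv : (0 : ℝ) ≤ v := v.cast_nonneg
  rw [norm_mul, norm_pow, Real.norm_eq_abs x, Real.norm_of_nonneg (by positivity), ← mul_assoc]
  refine mul_le_mul ?_ ?_ (by positivity) (by positivity)
  · calc ((r * v + k).descFactorial j : ℝ) / ((v : ℝ) + 1)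
        ≤ ((r * v + k).descFactorial j : ℝ) := div_le_self (by positivity) (by linarith)
      _ ≤ ((r * v + k : ℕ) : ℝ) ^ j := by exact_mod_cast Nat.descFactorial_le_pow _ _
      _ ≤ (((r : ℝ) + k) * ((v : ℝ) + 1)) ^ j := by
          apply pow_le_pow_left₀ (by positivity)
          push_cast
          nlinarith [mul_nonneg (Nat.cast_nonneg (α := ℝ) k) hv, Nat.cast_nonneg (α := ℝ) r]
      _ = _ := mul_pow _ _ _
  · calc |x| ^ (r * v + k - j) ≤ ρ ^ (r * v + k - j) := pow_le_pow_left₀ (abs_nonneg _) hx _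
      _ ≤ ρ ^ v := pow_le_pow_of_le_one h0 h1.le (by
          nlinarith [Nat.le_mul_of_pos_left v hr,
            Nat.sub_add_cancel (show j ≤ r * v + k by omega)])

theorem summable_norm_logSeries {k r j : ℕ} (hr : 1 ≤ r) (hj : j ≤ k) {x : ℝ} (hx : |x| < 1) :
    Summable fun v : ℕ =>
      ‖((r * v + k).descFactorial j : ℝ) / ((v : ℝ) + 1) * x ^ (r * v + k - j)‖ := by
  obtain ⟨ρ, hxρ, hρ⟩ := exists_between hx
  exact Summable.of_nonneg_of_le (fun _ => norm_nonneg _)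
    (norm_logSeries_term_le hr hj hxρ.le hρ)
    ((summable_succ_pow_mul_geometric j ((abs_nonneg x).trans_lt hxρ) hρ).mul_left _)

theorem hasDerivAt_logSeries {k r j : ℕ} (hr : 1 ≤ r) (hj : j < k) {x : ℝ} (hx : |x| < 1) :
    HasDerivAt (logSeries k r j) (logSeries k r (j + 1) x) x := by
  obtain ⟨ρ, hxρ, hρ⟩ := exists_between hx
  have h0 : 0 < ρ := (abs_nonneg x).trans_lt hxρ
  have hball : ∀ y : ℝ, y ∈ Metric.ball (0 : ℝ) ρ ↔ |y| < ρ := fun y => by simp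
  refine hasDerivAt_tsum_of_isPreconnected
    (((summable_succ_pow_mul_geometric (j + 1) h0 hρ).mul_left (((r : ℝ) + k) ^ (j + 1))))
    (t := Metric.ball 0 ρ) Metric.isOpen_ball (convex_ball 0 ρ).isPreconnected (fun v y _ => ?_)
    (fun v y hy => norm_logSeries_term_le hr hj ((hball y).1 hy).le hρ v)
    ((hball x).2 hxρ) (summable_norm_logSeries hr hj.le hx).of_norm ((hball x).2 hxρ)
  have h := (hasDerivAt_pow (r * v + k - j) y).const_mul
    (((r * v + k).descFactorial j : ℝ) / ((v : ℝ) + 1))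
  convert! h using 1
  rw [Nat.descFactorial_succ, Nat.sub_sub]
  push_cast
  ring

theorem logSeries_zero_right {k r j : ℕ} (hj : j < k) : logSeries k r j 0 = 0 := by
  unfold logSeries
  rw [tsum_congr fun v => ?_, tsum_zero]
  rw [zero_pow (by omega), mul_zero]

/-- Writing `rv + k = (k-r) + r(v+1)` exhibits the Taylor series of the logarithm in `x^r`. -/
theorem logSeries_zero {k r : ℕ} (hr : 1 ≤ r) (hrk : r ≤ k) {x : ℝ} (hx : |x| < 1) :
    logSeries k r 0 x = -(x ^ (k - r) * Real.log (1 - x ^ r)) := by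
  have hx' : |x ^ r| < 1 := by
    rw [abs_pow]; exact pow_lt_one₀ (abs_nonneg x) hx (by omega)
  have h := ((Real.hasSum_pow_div_log_of_abs_lt_one hx').mul_left (x ^ (k - r))).tsum_eq
  rw [← mul_neg, ← h]
  refine tsum_congr fun v => ?_
  have e : r * v + k = k - r + r * (v + 1) := by
    rw [mul_add]; omega
  rw [Nat.descFactorial_zero, Nat.sub_zero, e, pow_add, pow_mul]
  push_cast
  ring

/-- For a polynomial coefficient sequence of degree less than `k`, multiplying the generating
series by `(1 - z) ^ k` leaves a polynomial of degree less than `k`. -/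
theorem one_sub_pow_mul_tsum_eval {k : ℕ} (P : Polynomial ℝ) (hP : P.natDegree < k) {z : ℝ}
    (hs : Summable fun v : ℕ => ‖P.eval (v : ℝ) * z ^ v‖) :
    (1 - z) ^ k * ∑' v : ℕ, P.eval (v : ℝ) * z ^ v =
      ∑ j ∈ range k, z ^ j *
        ∑ v ∈ range (j + 1), (-1 : ℝ) ^ (j - v) * (k.choose (j - v) : ℝ) * P.eval (v : ℝ) := by
  set f : ℕ → ℝ := fun n => (-1) ^ n * (k.choose n : ℝ) * z ^ n with hf
  have hf0 : ∀ n ∉ range (k + 1), f n = 0 := fun n hn => by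
    have : k.choose n = 0 := Nat.choose_eq_zero_of_lt (by simpa using hn)
    simp [hf, this]
  have hfs : Summable fun n => ‖f n‖ :=
    summable_of_ne_finset_zero (s := range (k + 1)) fun n hn => by rw [hf0 n hn, norm_zero]
  have hft : ∑' n, f n = (1 - z) ^ k := by
    rw [tsum_eq_sum hf0, sub_eq_neg_add, add_pow]
    refine sum_congr rfl fun n _ => ?_
    rw [hf, one_pow, neg_pow]
    ring
  have hterm : ∀ n, ∑ kl ∈ antidiagonal n, f kl.1 * (P.eval (kl.2 : ℝ) * z ^ kl.2) =
      z ^ n * ∑ v ∈ range (n + 1),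
        (-1 : ℝ) ^ (n - v) * (k.choose (n - v) : ℝ) * P.eval (v : ℝ) := fun n => by
    rw [← Finset.Nat.sum_antidiagonal_swap, Finset.Nat.sum_antidiagonal_eq_sum_range_succ_mk,
      mul_sum]
    refine sum_congr rfl fun v hv => ?_
    have hvn : v ≤ n := by simpa [Nat.lt_succ_iff] using hv
    simp only [Prod.swap, hf]
    rw [← pow_sub_mul_pow z hvn]
    ring
  rw [← hft, tsum_mul_tsum_eq_tsum_sum_antidiagonal_of_summable_norm hfs hs, tsum_congr hterm]
  refine tsum_eq_sum fun n hn => ?_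
  have hkn : k ≤ n := by simpa using hn
  -- For `n ≥ k` the coefficient of `z^n` is the `k`-th forward difference of `P` at `n - k`, zero
  -- because `deg P < k`.
  have hΔ := congrFun (Polynomial.fwdDiff_iter_eq_zero_of_degree_lt hP) ((n - k : ℕ) : ℝ)
  rw [fwdDiff_iter_eq_sum_shift] at hΔ
  rw [mul_eq_zero]
  right
  obtain ⟨m, rfl⟩ := Nat.exists_eq_add_of_le' hkn
  rw [show m + k + 1 = m + (k + 1) by ring, sum_range_add]
  rw [sum_eq_zero fun v hv => ?_, zero_add]
  · refine Eq.trans (sum_congr rfl fun v hv => ?_) hΔ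
    have hvk : v ≤ k := by simpa [Nat.lt_succ_iff] using hv
    rw [show m + k - (m + v) = k - v by omega, Nat.choose_symm hvk]
    simp
  · have : v < m := by simpa using hv
    rw [Nat.choose_eq_zero_of_lt (by omega)]
    simp

/-- Among the `k` linear factors of the binomial coefficient, the one with `i = r - 1` is `r(v+1)`;
it cancels the denominator and leaves degree at most `k - 1`. -/
theorem exists_polynomial_choose_div {k r : ℕ} (hr : 1 ≤ r) (hrk : r ≤ k) :
    ∃ P : Polynomial ℝ, P.natDegree < k ∧
      ∀ v : ℕ, P.eval (v : ℝ) = ((r * v + k).choose k : ℝ) / ((v : ℝ) + 1) := by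
  open Polynomial in
  refine ⟨C ((r : ℝ) / (k.factorial : ℝ)) *
    ∏ i ∈ (range k).erase (r - 1), (C (r : ℝ) * X + C ((i : ℝ) + 1)), ?_, fun v => ?_⟩
  · refine (natDegree_C_mul_le _ _).trans_lt ((natDegree_prod_le _ _).trans_lt ?_)
    refine (sum_le_card_nsmul _ _ 1 fun i _ => natDegree_linear_le).trans_lt ?_
    rw [card_erase_of_mem (by simp; omega), card_range, smul_eq_mul]
    omega
  · have hv : (v : ℝ) + 1 ≠ 0 := by positivity
    have hk : (k.factorial : ℝ) ≠ 0 := by positivity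
    have h1 : ((r * v + k).choose k : ℝ) * (k.factorial : ℝ) =
        ∏ i ∈ range k, ((r : ℝ) * v + (i + 1)) := by
      rw [mul_comm]
      have := Nat.ascFactorial_eq_factorial_mul_choose (r * v) k
      rw [Nat.ascFactorial_eq_prod_range] at this
      have h2 : (((k.factorial * (r * v + k).choose k : ℕ)) : ℝ) = _ := congrArg _ this.symm
      push_cast at h2
      rw [h2]
      exact prod_congr rfl fun i _ => by ring
    rw [← mul_prod_erase _ _ (show r - 1 ∈ range k by simp; omega)] at h1
    rw [Nat.cast_sub hr] at h1
    simp only [eval_mul, eval_C, eval_prod, eval_add, eval_X]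
    rw [eq_div_iff hv, ← mul_right_cancel_iff_of_pos (show (0 : ℝ) < k.factorial by positivity), h1]
    field_simp
    push_cast
    ring

theorem one_sub_pow_mul_logSeries {k r : ℕ} (hr : 1 ≤ r) (hrk : r ≤ k) {x : ℝ} (hx : |x| < 1) :
    (1 - x ^ r) ^ k * logSeries k r k x = (k.factorial : ℝ) * (h k r).eval x := by
  obtain ⟨P, hP, hPv⟩ := exists_polynomial_choose_div hr hrk
  have hterm : ∀ v : ℕ, ((r * v + k).descFactorial k : ℝ) / ((v : ℝ) + 1) * x ^ (r * v + k - k) =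
      (k.factorial : ℝ) * (P.eval (v : ℝ) * (x ^ r) ^ v) := fun v => by
    rw [hPv, Nat.descFactorial_eq_factorial_mul_choose, Nat.add_sub_cancel, pow_mul]
    push_cast
    ring
  have hk : (k.factorial : ℝ) ≠ 0 := by positivity
  have hs : Summable fun v : ℕ => ‖P.eval (v : ℝ) * (x ^ r) ^ v‖ := by
    have := summable_norm_logSeries hr le_rfl hx (k := k)
    simp only [hterm, norm_mul (k.factorial : ℝ)] at this
    exact (summable_mul_left_iff (norm_ne_zero_iff.2 hk)).1 this
  rw [logSeries, tsum_congr hterm, tsum_mul_left, mul_left_comm,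
    one_sub_pow_mul_tsum_eval P hP hs, h, Polynomial.eval_finsetSum]
  congr 1
  refine sum_congr rfl fun j _ => ?_
  rw [Polynomial.eval_mul, Polynomial.eval_C, Polynomial.eval_pow, Polynomial.eval_X, pow_mul,
    mul_comm]
  congr 1
  refine sum_congr rfl fun v _ => ?_
  rw [hPv]
  ring

end EntropyReduction

/-! ### Rolle arguments. -/

namespace EntropyReduction

/-- If a function and its first `k - 1` derivatives vanish at `0`, then three zeros of the function
in `(0, 1)` yield three zeros of its `k`-th derivative. -/
theorem exists_three_zeros_iterated_deriv {F : ℕ → ℝ → ℝ} {k : ℕ}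
    (hF : ∀ j < k, ∀ x : ℝ, |x| < 1 → HasDerivAt (F j) (F (j + 1) x) x)
    (h0 : ∀ j < k, F j 0 = 0) {a b c : ℝ} (ha : 0 < a) (hab : a < b) (hbc : b < c) (hc : c < 1)
    (hFa : F 0 a = 0) (hFb : F 0 b = 0) (hFc : F 0 c = 0) :
    ∃ a b c : ℝ, 0 < a ∧ a < b ∧ b < c ∧ c < 1 ∧ F k a = 0 ∧ F k b = 0 ∧ F k c = 0 := by
  suffices ∀ j ≤ k, ∃ a b c : ℝ, 0 < a ∧ a < b ∧ b < c ∧ c < 1 ∧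
      F j a = 0 ∧ F j b = 0 ∧ F j c = 0 from this k le_rfl
  intro j
  induction j with
  | zero => exact fun _ => ⟨a, b, c, ha, hab, hbc, hc, hFa, hFb, hFc⟩
  | succ j ih =>
    intro hj
    obtain ⟨a, b, c, ha, hab, hbc, hc, hFa, hFb, hFc⟩ := ih (by omega)
    have hd : ∀ x : ℝ, 0 ≤ x → x < 1 → HasDerivAt (F j) (F (j + 1) x) x := fun x h h' =>
      hF j hj x (abs_lt.2 ⟨by linarith, h'⟩)
    have rolle : ∀ x y : ℝ, 0 ≤ x → x < y → y < 1 → F j x = 0 → F j y = 0 →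
        ∃ z ∈ Set.Ioo x y, F (j + 1) z = 0 := fun x y hx hxy hy hFx hFy =>
      exists_hasDerivAt_eq_zero hxy
        (fun z hz => (hd z (hx.trans hz.1) (hz.2.trans_lt hy)).continuousAt.continuousWithinAt)
        (hFx.trans hFy.symm) fun z hz => hd z (hx.trans hz.1.le) (hz.2.trans hy)
    -- The zero at `0` makes up for the one Rolle loses.
    obtain ⟨u, hu, hFu⟩ := rolle 0 a le_rfl ha (by linarith) (h0 j hj) hFa
    obtain ⟨v, hv, hFv⟩ := rolle a b ha.le hab (by linarith) hFa hFb
    obtain ⟨w, hw, hFw⟩ := rolle b c (by linarith) hbc hc hFb hFc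
    exact ⟨u, v, w, hu.1, hu.2.trans hv.1, hv.2.trans hw.1, hw.2.trans hc, hFu, hFv, hFw⟩

/-- A function on `(0, 1]` that vanishes at `1`, has a critical zero in `(0, 1)`, is nonnegative
somewhere near both ends and has at most two critical points is nonnegative. -/
theorem nonneg_of_not_three_critical_points {G G' : ℝ → ℝ}
    (hG : ∀ t ∈ Set.Ioo (0 : ℝ) 1, HasDerivAt G (G' t) t) (hc : ContinuousOn G (Set.Ioc 0 1))
    (hG1 : G 1 = 0) {t₀ : ℝ} (ht₀ : t₀ ∈ Set.Ioo (0 : ℝ) 1) (hGt₀ : G t₀ = 0) (hG't₀ : G' t₀ = 0)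
    (hleft : ∀ s ∈ Set.Ioo (0 : ℝ) 1, ∃ a ∈ Set.Ioo 0 s, 0 ≤ G a)
    (hright : ∀ s ∈ Set.Ioo (0 : ℝ) 1, ∃ b ∈ Set.Ioo s 1, 0 ≤ G b)
    (hthree : ¬ ∃ a b c : ℝ, 0 < a ∧ a < b ∧ b < c ∧ c < 1 ∧ G' a = 0 ∧ G' b = 0 ∧ G' c = 0)
    {s : ℝ} (hs : s ∈ Set.Ioo (0 : ℝ) 1) : 0 ≤ G s := by
  by_contra! hneg
  have rolle : ∀ x y : ℝ, 0 < x → x < y → y ≤ 1 → G x = 0 → G y = 0 →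
      ∃ z ∈ Set.Ioo x y, G' z = 0 := fun x y hx hxy hy hGx hGy =>
    exists_hasDerivAt_eq_zero hxy
      (hc.mono fun z hz => ⟨hx.trans_le hz.1, hz.2.trans hy⟩)
      (hGx.trans hGy.symm) fun z hz => hG z ⟨hx.trans hz.1, hz.2.trans_le hy⟩
  -- On either side, the new zero `z`, `t₀` and `1` bound two adjacent intervals; Rolle gives a
  -- critical point in each, and `t₀` is the third.
  rcases lt_trichotomy s t₀ with hst | rfl | hts
  · obtain ⟨a, ha, hGa⟩ := hleft s hs
    obtain ⟨z, hz, hGz⟩ := intermediate_value_Icc' ha.2.le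
      (hc.mono fun z hz => ⟨ha.1.trans_le hz.1, hz.2.trans hs.2.le⟩) ⟨hneg.le, hGa⟩
    obtain ⟨u, hu, hGu⟩ := rolle z t₀ (ha.1.trans_le hz.1) (hz.2.trans_lt hst) ht₀.2.le hGz hGt₀
    obtain ⟨v, hv, hGv⟩ := rolle t₀ 1 ht₀.1 ht₀.2 le_rfl hGt₀ hG1
    exact hthree ⟨u, t₀, v, (ha.1.trans_le hz.1).trans hu.1, hu.2, hv.1, hv.2, hGu, hG't₀, hGv⟩
  · exact hneg.ne hGt₀
  · obtain ⟨b, hb, hGb⟩ := hright s hs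
    obtain ⟨z, hz, hGz⟩ := intermediate_value_Icc hb.1.le
      (hc.mono fun z hz => ⟨hs.1.trans_le hz.1, hz.2.trans hb.2.le⟩) ⟨hneg.le, hGb⟩
    have hz1 : z < 1 := hz.2.trans_lt hb.2
    have htz : t₀ < z := hts.trans_le hz.1
    obtain ⟨u, hu, hGu⟩ := rolle t₀ z ht₀.1 htz hz1.le hGt₀ hGz
    obtain ⟨v, hv, hGv⟩ := rolle z 1 (ht₀.1.trans htz) hz1 le_rfl hGz hG1
    exact hthree ⟨t₀, u, v, ht₀.1, hu.1, hu.2.trans hv.1, hv.2, hG't₀, hGu, hGv⟩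

/-! ### The entropy quotient, the constant `α`, and root counting. -/

theorem hasDerivAt_binEntropy_pow_div {n : ℕ} (hn : 1 ≤ n) {t : ℝ} (ht : t ∈ Set.Ioo (0 : ℝ) 1) :
    HasDerivAt (fun t : ℝ => Real.binEntropy (t ^ n) / t ^ n)
      (n * Real.log (1 - t ^ n) / t ^ (n + 1)) t := by
  have hpos : 0 < t ^ n := pow_pos ht.1 n
  have hlt : t ^ n < 1 := pow_lt_one₀ ht.1.le ht.2 (by omega)
  have hp := hasDerivAt_pow n t
  have hH : HasDerivAt (fun t : ℝ => Real.binEntropy (t ^ n))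
      ((Real.log (1 - t ^ n) - Real.log (t ^ n)) * (n * t ^ (n - 1))) t :=
    (Real.hasDerivAt_binEntropy hpos.ne' hlt.ne).comp t hp
  refine (hH.div hp hpos.ne').congr_deriv ?_
  have ht' := ht.1.ne'
  obtain ⟨m, rfl⟩ := Nat.exists_eq_add_of_le' hn
  simp only [Real.binEntropy, Real.log_inv, Nat.add_sub_cancel]
  field_simp
  ring

theorem neg_mul_log_le_binEntropy {u : ℝ} (h0 : 0 ≤ u) (h1 : u ≤ 1) :
    -(u * Real.log u) ≤ Real.binEntropy u := by
  have := mul_nonneg_of_nonpos_of_nonpos (Real.log_nonpos (sub_nonneg.2 h1) (by linarith))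
    (show -(1 - u) ≤ 0 by linarith)
  rw [Real.binEntropy, Real.log_inv, Real.log_inv]
  linarith

theorem binEntropy_le_self_sub_mul_log {u : ℝ} (h1 : u < 1) :
    Real.binEntropy u ≤ u - u * Real.log u := by
  have hu : 0 < 1 - u := by linarith
  have := mul_le_mul_of_nonneg_left (Real.one_sub_inv_le_log_of_pos hu) hu.le
  rw [mul_sub, mul_inv_cancel₀ hu.ne'] at this
  rw [Real.binEntropy, Real.log_inv, Real.log_inv]
  linarith

theorem alpha_mul_rpow {κ : ℝ} (hκ : 1 ≤ κ) : alpha κ * (1 + alpha κ) ^ (κ - 1) = 1 := by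
  have h := alpha_spec hκ
  have h2 : 0 < (1 + alpha κ) ^ (κ - 1) := Real.rpow_pos_of_pos (by linarith [h.1.1]) _
  exact (eq_div_iff h2.ne').1 h.2

/-- If `α ≤ 1/κ`, then `log α + (κ-1) log(1+α) ≤ -log κ + 1 - 1/κ < 0`, contradicting the defining
equation. This fixes the sign of `G` near both ends. -/
theorem one_lt_alpha_mul {κ : ℝ} (hκ : 1 < κ) : 1 < alpha κ * κ := by
  have h0 : 0 < κ := by linarith
  have ha := (alpha_spec hκ.le).1.1
  by_contra! hle
  have hα : alpha κ ≤ κ⁻¹ := by rwa [← one_div, le_div_iff₀ h0]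
  have hlog := congrArg Real.log (alpha_mul_rpow hκ.le)
  rw [Real.log_mul ha.ne' (Real.rpow_pos_of_pos (by linarith) _).ne',
    Real.log_rpow (by linarith), Real.log_one] at hlog
  have h1 : Real.log (alpha κ) ≤ -Real.log κ := by
    rw [← Real.log_inv]; exact Real.log_le_log ha hα
  have h2 : Real.log (1 + alpha κ) ≤ κ⁻¹ :=
    (Real.log_le_sub_one_of_pos (by linarith)).trans (by linarith)
  have h3 : -Real.log κ < κ⁻¹ - 1 := by
    rw [← Real.log_inv]
    exact Real.log_lt_sub_one_of_pos (by positivity) (inv_lt_one_of_one_lt₀ hκ).ne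
  have h4 := mul_le_mul_of_nonneg_left h2 (show 0 ≤ κ - 1 by linarith)
  rw [sub_mul κ 1 κ⁻¹, mul_inv_cancel₀ h0.ne'] at h4
  linarith

/-- `a (1+a)^(κ-1)` increases strictly in `a` and weakly in `κ`. -/
theorem alpha_antitoneOn : AntitoneOn alpha (Set.Ici 1) := by
  intro κ hκ q hq hκq
  have hκ' := (alpha_spec hκ).1.1
  by_contra! hlt
  have h1 := alpha_mul_rpow hκ
  have h2 := alpha_mul_rpow hq
  have h3 : (1 + alpha κ) ^ (κ - 1) ≤ (1 + alpha q) ^ (q - 1) :=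
    (Real.rpow_le_rpow (by linarith) (by linarith) (sub_nonneg.2 hκ)).trans
      (Real.rpow_le_rpow_of_exponent_le (by linarith) (by linarith))
  have h4 : 0 < (1 + alpha κ) ^ (κ - 1) := Real.rpow_pos_of_pos (by linarith) _
  nlinarith

/-- With `w = α_{k/r} k log (1 - x ^ k) - r x ^ (k - r) log (1 - x ^ r)`, three zeros of `w` in
`(0, 1)` contradict the root count of the entropy polynomial. -/
theorem HasExactlyTwoRoots.not_three_zeros {k r : ℕ} (hr : 1 ≤ r) (hrk : r < k)
    (H : HasExactlyTwoRoots k r) :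
    ¬ ∃ a b c : ℝ, 0 < a ∧ a < b ∧ b < c ∧ c < 1 ∧
      (∀ t ∈ ({a, b, c} : Set ℝ), alpha ((k : ℝ) / r) * k * Real.log (1 - t ^ k) -
        r * (t ^ (k - r) * Real.log (1 - t ^ r)) = 0) := by
  rintro ⟨a, b, c, ha, hab, hbc, hc, hw⟩
  set W : ℕ → ℝ → ℝ := fun j x =>
    (r : ℝ) * logSeries k r j x - alpha ((k : ℝ) / r) * k * logSeries k k j x with hW
  have hk : 1 ≤ k := hr.trans hrk.le
  have hW0 : ∀ t ∈ ({a, b, c} : Set ℝ), W 0 t = 0 := by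
    intro t ht
    have ht1 : |t| < 1 := by
      rw [abs_lt]
      simp only [Set.mem_insert_iff, Set.mem_singleton_iff] at ht
      rcases ht with rfl | rfl | rfl <;> constructor <;> linarith
    simp only [hW]
    rw [logSeries_zero hr hrk.le ht1, logSeries_zero hk le_rfl ht1, Nat.sub_self, pow_zero,
      ← hw t ht]
    ring
  obtain ⟨a, b, c, ha, hab, hbc, hc, hWa, hWb, hWc⟩ :=
    exists_three_zeros_iterated_deriv (F := W) (k := k)
      (fun j hj x hx => ((hasDerivAt_logSeries hr hj hx).const_mul _).sub
        ((hasDerivAt_logSeries hk hj hx).const_mul _))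
      (fun j hj => by simp [hW, logSeries_zero_right hj])
      ha hab hbc hc (hW0 a (by simp)) (hW0 b (by simp)) (hW0 c (by simp))
  have hp : p k r ≠ 0 := by
    intro h0
    simp [HasExactlyTwoRoots, h0] at H
  classical
  have hmem : ∀ t : ℝ, 0 < t → t < 1 → W k t = 0 →
      t ∈ (p k r).roots.filter (fun x => x ∈ Set.Ioo (0 : ℝ) 1) := by
    intro t h0 h1 hWt
    rw [Multiset.mem_filter, Polynomial.mem_roots hp]
    refine ⟨?_, h0, h1⟩
    have ht1 : |t| < 1 := abs_lt.2 ⟨by linarith, h1⟩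
    have e1 := one_sub_pow_mul_logSeries hr hrk.le ht1
    have e2 := one_sub_pow_mul_logSeries hk le_rfl ht1
    have hf : (k.factorial : ℝ) ≠ 0 := by positivity
    simp only [hW] at hWt
    rw [Polynomial.IsRoot.def, p]
    simp only [Polynomial.eval_sub, Polynomial.eval_mul, Polynomial.eval_C, Polynomial.eval_pow,
      Polynomial.eval_one, Polynomial.eval_X]
    -- This rests on `(1-t^r)^k (1-t^k)^k W k t = -k! p(t)`.
    refine (mul_eq_zero_iff_left hf).1 ?_
    linear_combination (-(alpha ((k : ℝ) / r) * k * (1 - t ^ r) ^ k)) * e2 +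
      (r * (1 - t ^ k) ^ k) * e1 - (1 - t ^ r) ^ k * (1 - t ^ k) ^ k * hWt
  have hsub : ({a, b, c} : Finset ℝ) ⊆
      ((p k r).roots.filter (fun x => x ∈ Set.Ioo (0 : ℝ) 1)).toFinset := by
    intro t ht
    rw [Multiset.mem_toFinset]
    simp only [Finset.mem_insert, Finset.mem_singleton] at ht
    rcases ht with rfl | rfl | rfl
    · exact hmem _ ha (by linarith) hWa
    · exact hmem _ (by linarith) (by linarith) hWb
    · exact hmem _ (by linarith) hc hWc
  have hcard := (Finset.card_le_card hsub).trans (Multiset.toFinset_card_le _)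
  rw [Finset.card_eq_three.2 ⟨a, b, c, hab.ne, (hab.trans hbc).ne, hbc.ne, rfl⟩] at hcard
  have H' : Multiset.card ((p k r).roots.filter (fun x => x ∈ Set.Ioo (0 : ℝ) 1)) = 2 := by
    unfold HasExactlyTwoRoots at H
    convert H
  omega

end EntropyReduction

/-! ### The inequality for rational, then real exponents. -/

namespace EntropyReduction

open Filter Topology

theorem HasExactlyTwoRoots.binEntropy_pow_ineq {k r : ℕ} (hr : 1 ≤ r) (hrk : r < k)
    (H : HasExactlyTwoRoots k r) {s : ℝ} (hs : s ∈ Set.Ioo (0 : ℝ) 1) :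
    0 ≤ alpha ((k : ℝ) / r) * (Real.binEntropy (s ^ k) / s ^ k) -
      Real.binEntropy (s ^ r) / s ^ r := by
  have hk : 1 ≤ k := hr.trans hrk.le
  have hr0 : (0 : ℝ) < r := by exact_mod_cast hr
  have hκ : 1 < (k : ℝ) / r := (one_lt_div hr0).2 (by exact_mod_cast hrk)
  set α := alpha ((k : ℝ) / r) with hα
  obtain ⟨hα0, hα1⟩ := (alpha_spec hκ.le).1
  rw [← hα] at hα0 hα1
  have hαk : 0 < α * k - r := by
    have := one_lt_alpha_mul hκ
    rw [← hα, ← mul_div_assoc, lt_div_iff₀ hr0] at this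
    linarith
  set w : ℝ → ℝ := fun t => α * k * Real.log (1 - t ^ k) -
    r * (t ^ (k - r) * Real.log (1 - t ^ r)) with hw
  set G : ℝ → ℝ := fun t => α * (Real.binEntropy (t ^ k) / t ^ k) -
    Real.binEntropy (t ^ r) / t ^ r with hG
  have hGd : ∀ t ∈ Set.Ioo (0 : ℝ) 1, HasDerivAt G (w t / t ^ (k + 1)) t := by
    intro t ht
    refine (((hasDerivAt_binEntropy_pow_div hk ht).const_mul α).sub
      (hasDerivAt_binEntropy_pow_div hr ht)).congr_deriv ?_
    have ht' := ht.1.ne'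
    obtain ⟨m, rfl⟩ := Nat.exists_eq_add_of_lt hrk
    simp only [hw]
    rw [show r + m + 1 - r = m + 1 by omega]
    field_simp
    ring
  have hGc : ContinuousOn G (Set.Ioc 0 1) := by
    have h : ∀ n : ℕ, ContinuousOn (fun t : ℝ => Real.binEntropy (t ^ n) / t ^ n) (Set.Ioc 0 1) :=
      fun n => ContinuousOn.div (by fun_prop) (by fun_prop) fun t ht => (pow_pos ht.1 n).ne'
    exact ((h k).const_smul α).sub (h r)
  have hG1 : G 1 = 0 := by simp [hG]
  have hw0 : ∀ t ∈ Set.Ioo (0 : ℝ) 1, w t / t ^ (k + 1) = 0 → w t = 0 := fun t ht h =>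
    (div_eq_zero_iff.1 h).resolve_right (pow_pos ht.1 _).ne'
  -- the point of equality
  set x₀ : ℝ := 1 / (1 + α) with hx₀
  have hx₀0 : 0 < x₀ := by positivity
  have hx₀1 : x₀ < 1 := by rw [hx₀, div_lt_one (by linarith)]; linarith
  set t₀ : ℝ := x₀ ^ ((r : ℝ)⁻¹) with ht₀
  have ht₀I : t₀ ∈ Set.Ioo (0 : ℝ) 1 :=
    ⟨Real.rpow_pos_of_pos hx₀0 _, Real.rpow_lt_one hx₀0.le hx₀1 (by positivity)⟩
  have ht₀r : t₀ ^ r = x₀ := Real.rpow_inv_natCast_pow hx₀0.le (by omega)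
  have ht₀kr : t₀ ^ (k - r) = α := by
    rw [ht₀, ← Real.rpow_natCast, ← Real.rpow_mul hx₀0.le, Nat.cast_sub hrk.le,
      show (r : ℝ)⁻¹ * ((k : ℝ) - r) = (k : ℝ) / r - 1 by field_simp, hx₀,
      Real.div_rpow zero_le_one (by linarith), Real.one_rpow]
    exact (alpha_spec hκ.le).2.symm
  have ht₀k : t₀ ^ k = 1 - t₀ ^ r := by
    rw [← Nat.sub_add_cancel hrk.le, pow_add, ht₀kr, ht₀r, hx₀]
    field_simp
    ring
  have hGt₀ : G t₀ = 0 := by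
    have h1 : t₀ ^ k = α * t₀ ^ r := by
      rw [← ht₀kr, ← pow_add, Nat.sub_add_cancel hrk.le]
    have h2 : Real.binEntropy (t₀ ^ k) = Real.binEntropy (t₀ ^ r) := by
      rw [ht₀k, Real.binEntropy_one_sub]
    simp only [hG]
    rw [h2, h1]
    field_simp
    ring
  have hwt₀ : w t₀ = 0 := by
    simp only [hw]
    rw [ht₀kr, show 1 - t₀ ^ k = t₀ ^ r by linarith, ← ht₀k, Real.log_pow, Real.log_pow]
    ring
  -- behaviour at the left end
  have hleft : ∀ s ∈ Set.Ioo (0 : ℝ) 1, ∃ a ∈ Set.Ioo 0 s, 0 ≤ G a := by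
    intro s hs
    -- The entropy bounds below give `G(a) ≥ -(αk - r) log a - 1`.
    have h1 := (Real.tendsto_log_nhdsGT_zero.const_mul_atBot hαk).eventually_le_atBot (-1)
    obtain ⟨a, ha, has⟩ := (h1.and (Ioo_mem_nhdsGT hs.1)).exists
    refine ⟨a, has, ?_⟩
    have hpow : ∀ n : ℕ, 1 ≤ n → 0 < a ^ n ∧ a ^ n < 1 := fun n hn =>
      ⟨pow_pos has.1 n, pow_lt_one₀ has.1.le (has.2.trans hs.2) (by omega)⟩
    have h2 : -(k * Real.log a) ≤ Real.binEntropy (a ^ k) / a ^ k := by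
      rw [le_div_iff₀ (hpow k hk).1, ← Real.log_pow]
      linarith [neg_mul_log_le_binEntropy (hpow k hk).1.le (hpow k hk).2.le]
    have h3 : Real.binEntropy (a ^ r) / a ^ r ≤ 1 - r * Real.log a := by
      rw [div_le_iff₀ (hpow r hr).1, ← Real.log_pow]
      linarith [binEntropy_le_self_sub_mul_log (hpow r hr).2]
    have h4 := mul_le_mul_of_nonneg_left h2 hα0.le
    simp only [hG]
    linarith
  -- behaviour at the right end
  have hright : ∀ s ∈ Set.Ioo (0 : ℝ) 1, ∃ b ∈ Set.Ioo s 1, 0 ≤ G b := by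
    intro s hs
    have hsub : Tendsto (fun t : ℝ => 1 - t) (𝓝[<] 1) (𝓝[>] 0) := by
      refine tendsto_nhdsWithin_iff.2 ⟨?_, ?_⟩
      · have : Tendsto (fun t : ℝ => 1 - t) (𝓝 1) (𝓝 (1 - 1)) :=
          tendsto_const_nhds.sub tendsto_id
        rw [sub_self] at this
        exact this.mono_left nhdsWithin_le_nhds
      · filter_upwards [self_mem_nhdsWithin] with t ht
        exact Set.mem_Ioi.2 (sub_pos.2 (Set.mem_Iio.1 ht))
    -- By Bernoulli `1 - t^k ≤ k(1-t)`, so `w(t) ≤ αk log k + (αk - r) log(1-t)`, negative near `1`;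
    -- there `G` decreases to `G(1) = 0`.
    have h1 := ((Real.tendsto_log_nhdsGT_zero.const_mul_atBot hαk).comp hsub).eventually_lt_atBot
      (-(α * k * Real.log k))
    obtain ⟨δ, hδ, hδw⟩ := (mem_nhdsLT_iff_exists_Ioo_subset' (show s < 1 from hs.2)).1
      (inter_mem h1 (Ioo_mem_nhdsLT hs.2))
    have hneg : ∀ t ∈ Set.Ioo δ 1, w t < 0 := by
      intro t ht
      obtain ⟨hlog, hts⟩ := hδw ht
      have ht0 : 0 < t := hs.1.trans hts.1
      have ht1 : 0 < 1 - t := by linarith [hts.2]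
      have hk0 : (0 : ℝ) < k := by exact_mod_cast hk
      have hk1 : 0 < 1 - t ^ k := sub_pos.2 (pow_lt_one₀ ht0.le hts.2 (by omega))
      have e1 : Real.log (1 - t ^ k) ≤ Real.log k + Real.log (1 - t) := by
        rw [← Real.log_mul hk0.ne' ht1.ne']
        refine Real.log_le_log hk1 ?_
        have := one_add_mul_sub_le_pow (show -1 ≤ t by linarith) k
        linarith
      have e2 : Real.log (1 - t) ≤ Real.log (1 - t ^ r) :=
        Real.log_le_log ht1 (sub_le_sub_left (pow_le_of_le_one ht0.le hts.2.le (by omega)) _)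
      have e3 : Real.log (1 - t ^ r) ≤ 0 :=
        Real.log_nonpos (sub_nonneg.2 (pow_le_one₀ ht0.le hts.2.le))
          (by linarith [pow_pos ht0 r])
      have e4 : Real.log (1 - t ^ r) ≤ t ^ (k - r) * Real.log (1 - t ^ r) := by
        nlinarith [pow_le_one₀ (n := k - r) ht0.le hts.2.le]
      have e5 := mul_le_mul_of_nonneg_left e1 (mul_pos hα0 hk0).le
      have e6 := mul_le_mul_of_nonneg_left (e2.trans e4) hr0.le
      simp only [Function.comp, Set.mem_ofPred_eq] at hlog
      simp only [hw]
      linarith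
    obtain ⟨b, hb, hb1⟩ := exists_between (max_lt hs.2 hδ)
    have hsb : s < b := (le_max_left _ _).trans_lt hb
    have hδb : δ < b := (le_max_right _ _).trans_lt hb
    have hb0 : 0 < b := hs.1.trans hsb
    obtain ⟨c, hc, hcs⟩ := exists_hasDerivAt_eq_slope G _ hb1
      (hGc.mono fun z hz => ⟨hb0.trans_le hz.1, hz.2⟩)
      fun z hz => hGd z ⟨hb0.trans hz.1, hz.2⟩
    refine ⟨b, ⟨hsb, hb1⟩, ?_⟩
    have h2 : w c / c ^ (k + 1) < 0 :=
      div_neg_of_neg_of_pos (hneg c ⟨hδb.trans hc.1, hc.2⟩) (pow_pos (hb0.trans hc.1) _)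
    rw [hcs, hG1, div_lt_iff₀ (by linarith)] at h2
    linarith
  refine nonneg_of_not_three_critical_points hGd hGc hG1 ht₀I hGt₀ (by rw [hwt₀, zero_div])
    hleft hright ?_ hs
  rintro ⟨a, b, c, ha, hab, hbc, hc, hwa, hwb, hwc⟩
  refine H.not_three_zeros hr hrk ⟨a, b, c, ha, hab, hbc, hc, ?_⟩
  rintro t (rfl | rfl | rfl)
  · exact hw0 _ ⟨ha, by linarith⟩ hwa
  · exact hw0 _ ⟨by linarith, by linarith⟩ hwb
  · exact hw0 _ ⟨by linarith, hc⟩ hwc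

theorem HasExactlyTwoRoots.binEntropy_rpow_ineq {k r : ℕ} (hr : 1 ≤ r) (hrk : r < k)
    (H : HasExactlyTwoRoots k r) {x : ℝ} (hx : x ∈ Set.Icc (0 : ℝ) 1) :
    x ^ ((k : ℝ) / r - 1) * Real.binEntropy x ≤
      alpha ((k : ℝ) / r) * Real.binEntropy (x ^ ((k : ℝ) / r)) := by
  have hr0 : (0 : ℝ) < r := by exact_mod_cast hr
  have hκ : 1 < (k : ℝ) / r := (one_lt_div hr0).2 (by exact_mod_cast hrk)
  rcases hx.1.eq_or_lt with rfl | h0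
  · rw [Real.zero_rpow (by linarith : (k : ℝ) / r ≠ 0)]
    simp
  rcases hx.2.eq_or_lt with rfl | h1
  · simp
  set t : ℝ := x ^ ((r : ℝ)⁻¹) with ht
  have htI : t ∈ Set.Ioo (0 : ℝ) 1 :=
    ⟨Real.rpow_pos_of_pos h0 _, Real.rpow_lt_one h0.le h1 (by positivity)⟩
  have htr : t ^ r = x := Real.rpow_inv_natCast_pow h0.le (by omega)
  have htk : t ^ k = x ^ ((k : ℝ) / r) := by
    rw [ht, ← Real.rpow_natCast, ← Real.rpow_mul h0.le, inv_mul_eq_div]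
  have h := H.binEntropy_pow_ineq hr hrk htI
  rw [htr, htk] at h
  have hpos : 0 < x ^ ((k : ℝ) / r) := Real.rpow_pos_of_pos h0 _
  have h2 := mul_nonneg h hpos.le
  rw [Real.rpow_sub_one h0.ne', div_mul_eq_mul_div]
  have e : (alpha ((k : ℝ) / r) * (Real.binEntropy (x ^ ((k : ℝ) / r)) / x ^ ((k : ℝ) / r)) -
      Real.binEntropy x / x) * x ^ ((k : ℝ) / r) =
      alpha ((k : ℝ) / r) * Real.binEntropy (x ^ ((k : ℝ) / r)) -
        x ^ ((k : ℝ) / r) * Real.binEntropy x / x := by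
    field_simp
  linarith

theorem binEntropy_rpow_ineq_of_rat
    (H : ∀ q : ℚ, 1 < q → ∀ x ∈ Set.Icc (0 : ℝ) 1,
      x ^ ((q : ℝ) - 1) * Real.binEntropy x ≤ alpha q * Real.binEntropy (x ^ (q : ℝ)))
    {κ : ℝ} (hκ : 1 ≤ κ) {x : ℝ} (hx : x ∈ Set.Icc (0 : ℝ) 1) :
    x ^ (κ - 1) * Real.binEntropy x ≤ alpha κ * Real.binEntropy (x ^ κ) := by
  rcases hx.1.eq_or_lt with rfl | h0
  · rw [Real.zero_rpow (by linarith : κ ≠ 0)]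
    simp
  -- Only rationals `q > κ` are used: then `alpha q ≤ alpha κ`, so `alpha κ` stays fixed in the
  -- limit and no continuity of `alpha` is needed.
  have hcl : κ ∈ closure (Set.Ioi κ ∩ Set.range ((↑) : ℚ → ℝ)) := by
    have h := (Rat.isDenseEmbedding_coe_real.dense).open_subset_closure_inter (isOpen_Ioi (a := κ))
    exact closure_minimal h isClosed_closure (by rw [closure_Ioi]; exact Set.self_mem_Ici)
  have hclosed : IsClosed {q : ℝ | x ^ (q - 1) * Real.binEntropy x ≤
      alpha κ * Real.binEntropy (x ^ q)} := by
    have hc : Continuous fun q : ℝ => x ^ q := Real.continuous_const_rpow h0.ne'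
    exact isClosed_le ((hc.comp (continuous_sub_right 1)).mul continuous_const)
      (continuous_const.mul (Real.binEntropy_continuous.comp hc))
  refine closure_minimal ?_ hclosed hcl
  rintro _ ⟨hq, q, rfl⟩
  have hκq : κ < q := hq
  refine (H q (by exact_mod_cast hκ.trans_lt hκq) x hx).trans ?_
  refine mul_le_mul_of_nonneg_right
    (alpha_antitoneOn hκ (show (1 : ℝ) ≤ q from hκ.trans hκq.le) hκq.le)
    (Real.binEntropy_nonneg (Real.rpow_nonneg hx.1 _) (Real.rpow_le_one hx.1 hx.2 ?_))
  linarith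

end EntropyReduction

theorem theorem1p3 :
    (∀ k r : ℕ, 1 ≤ r → r < k → EntropyReduction.HasExactlyTwoRoots k r →
      ∀ x ∈ Set.Icc (0 : ℝ) 1,
        EntropyReduction.alpha ((k : ℝ) / (r : ℝ)) * Real.binEntropy (x ^ ((k : ℝ) / (r : ℝ)))
          ≥ x ^ ((k : ℝ) / (r : ℝ) - 1) * Real.binEntropy x) ∧
    ((∀ k r : ℕ, 1 ≤ r → r < k → Nat.Coprime k r → EntropyReduction.HasExactlyTwoRoots k r) →
      ∀ k : ℝ, 1 ≤ k → ∀ x ∈ Set.Icc (0 : ℝ) 1,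
        EntropyReduction.alpha k * Real.binEntropy (x ^ k)
          ≥ x ^ (k - 1) * Real.binEntropy x) := by
  refine ⟨fun k r hr hrk H x hx => H.binEntropy_rpow_ineq hr hrk hx, fun H k hk x hx => ?_⟩
  refine EntropyReduction.binEntropy_rpow_ineq_of_rat (fun q hq x hx => ?_) hk hx
  obtain ⟨n, hn⟩ := Int.eq_ofNat_of_zero_le (Rat.num_nonneg.2 (zero_le_one.trans hq.le))
  have hqn : (q : ℝ) = (n : ℝ) / (q.den : ℝ) := by
    rw [Rat.cast_def, hn]
    simp
  have hlt : q.den < n := by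
    have h1 : (1 : ℝ) < q := by exact_mod_cast hq
    rw [hqn, one_lt_div (by exact_mod_cast q.pos)] at h1
    exact_mod_cast h1
  have hco : Nat.Coprime n q.den := by
    have := q.reduced
    rwa [hn, Int.natAbs_natCast] at this
  rw [hqn]
  exact (H n q.den q.pos hlt hco).binEntropy_rpow_ineq q.pos hlt hx
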